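/- Let $G=\mathbb H(3;\mathbb R)\times\mathbb H(3;\mathbb R)\times\mathbb R^2$, where $\mathbb H(3;\mathbb R)$ is the real Heisenberg group, let $\Gamma\subset G$ be a lattice (a discrete subgroup with $M=\Gamma\backslash G$ compact), and let $M$ carry the complex structure defined by a left-invariant coframe $\{\eta^1,\eta^2,\eta^3,\eta^4\}$ of $(1,0)$-forms with structure equations $$d\eta^1=d\eta^2=0,\qquad d\eta^3=\kappa\,\eta^1\wedge\bar\eta^1,\qquad d\eta^4=\kappa\,\eta^2\wedge\bar\eta^2,$$ where $\kappa\neq0$ is a constant. Let $\{Z_j\}$ be the dual frame, let $a_{11},a_{22},a_{32},a_{33},a_{34},a_{41},a_{43},a_{44}\in\mathbb C$, and consider the curve of deformations $$\phi(t)=t\big(a_{11}\bar\eta^1\otimes Z_1+a_{22}\bar\eta^2\otimes Z_2+a_{32}\bar\eta^2\otimes Z_3+a_{33}\bar\eta^3\otimes Z_3+a_{34}\bar\eta^4\otimes Z_3+a_{41}\bar\eta^1\otimes Z_4+a_{43}\bar\eta^3\otimes Z_4+a_{44}\bar\eta^4\otimes Z_4\big),\quad t\in(-\epsilon,\epsilon),$$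 where $\epsilon>0$ is so small that for all these $t$ the forms $\eta^j_t:=\eta^j+i_{\phi(t)}\eta^j$ and their conjugates are linearly independent at each point; let $M_t$ be $M$ with the complex structure whose $(1,0)$-forms are spanned by $\eta^1_t,\dots,\eta^4_t$. Let $\{\omega_t\}_{t\in(-\epsilon,\epsilon)}$ be a smooth curve of invariant Hermitian metrics on $M_t$, $$\omega_t=\frac i2\sum_{j=1}^4\alpha_{j\bar j}(t)\,\eta_t^j\wedge\overline{\eta_t^j}+\frac12\sum_{j<k}\Big(\alpha_{j\bar k}(t)\,\eta_t^j\wedge\overline{\eta_t^k}-\overline{\alpha_{j\bar k}(t)}\,\eta_t^k\wedge\overline{\eta_t^j}\Big),$$ that is, the $\alpha_{j\bar k}(t)$ are smooth in $t$ and the Hermitian matrix with diagonal entries $\alpha_{j\bar j}(t)$ and entries $-i\alpha_{j\bar k}(t)$ for $j<k$ is positive definite. Put $\alpha_{j\bar k}=\alpha_{j\bar k}(0)$ and $$L=i\alpha_{3\bar3}(a_{34}+\bar a_{34})+i\alpha_{4\bar4}(a_{43}+\bar a_{43})+\alpha_{3\bar4}(a_{33}+\bar a_{44})-\bar\alpha_{3\bar4}(a_{44}+\bar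 a_{33}).$$ If $\omega_t$ is SKT, i.e. $\partial_t\bar\partial_t\omega_t=0$ on $M_t$, for all $t\in(-\epsilon,\epsilon)$, then $$L=2i\,\mathrm{Im}\big(\alpha_{3\bar4}'(0)\big)\ \text{ if }\kappa\text{ is real (for example }\kappa=-\tfrac12),\qquad L=-2i\,\mathrm{Im}\big(\alpha_{3\bar4}'(0)\big)\ \text{ if }\kappa\text{ is purely imaginary (for example }\kappa=-\tfrac i2).$$ -/

import Mathlib

open Complex Set
open scoped ContDiff ComplexOrder

/-! ## The Lie group `H(3;ℝ) × H(3;ℝ) × ℝ²` -/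

/-- The coordinate space of the Lie group. The indices `0, …, 7` stand for the standard real
coordinates `x¹, …, x⁸`. -/
abbrev CoordSpace : Type := Fin 8 → ℝ

/-- The Lie group `G = H(3;ℝ) × H(3;ℝ) × ℝ²` in its standard global coordinates: `(x¹, x², x³)` on
the first Heisenberg group, `(x⁴, x⁵, x⁶)` on the second one and `(x⁷, x⁸)` on `ℝ²`. -/
def NilGroup : Type := CoordSpace

namespace NilGroup

instance : TopologicalSpace NilGroup := inferInstanceAs (TopologicalSpace CoordSpace)

instance : Mul NilGroup where
  mul x y :=
    (![x 0 + y 0, x 1 + y 1, x 2 + y 2 + x 0 * y 1,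
       x 3 + y 3, x 4 + y 4, x 5 + y 5 + x 3 * y 4,
       x 6 + y 6, x 7 + y 7] : CoordSpace)

instance : One NilGroup where
  one := (0 : CoordSpace)

instance : Inv NilGroup where
  inv x :=
    (![-x 0, -x 1, -x 2 + x 0 * x 1, -x 3, -x 4, -x 5 + x 3 * x 4, -x 6, -x 7] : CoordSpace)

theorem ext_coord {x y : NilGroup} (h0 : x 0 = y 0) (h1 : x 1 = y 1) (h2 : x 2 = y 2)
    (h3 : x 3 = y 3) (h4 : x 4 = y 4) (h5 : x 5 = y 5) (h6 : x 6 = y 6) (h7 : x 7 = y 7) :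
    x = y := by
  funext i
  fin_cases i <;> assumption

instance : Group NilGroup :=
  Group.ofLeftAxioms
    (fun x y z => by
      apply ext_coord
      · exact add_assoc (x 0) (y 0) (z 0)
      · exact add_assoc (x 1) (y 1) (z 1)
      · change (x 2 + y 2 + x 0 * y 1) + z 2 + (x 0 + y 0) * z 1 =
          x 2 + (y 2 + z 2 + y 0 * z 1) + x 0 * (y 1 + z 1)
        ring
      · exact add_assoc (x 3) (y 3) (z 3)
      · exact add_assoc (x 4) (y 4) (z 4)
      · change (x 5 + y 5 + x 3 * y 4) + z 5 + (x 3 + y 3) * z 4 =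
          x 5 + (y 5 + z 5 + y 3 * z 4) + x 3 * (y 4 + z 4)
        ring
      · exact add_assoc (x 6) (y 6) (z 6)
      · exact add_assoc (x 7) (y 7) (z 7))
    (fun x => by
      apply ext_coord
      · exact zero_add (x 0)
      · exact zero_add (x 1)
      · change 0 + x 2 + 0 * x 1 = x 2
        ring
      · exact zero_add (x 3)
      · exact zero_add (x 4)
      · change 0 + x 5 + 0 * x 4 = x 5
        ring
      · exact zero_add (x 6)
      · exact zero_add (x 7))
    (fun x => by
      apply ext_coord
      · exact neg_add_cancel (x 0)
      · exact neg_add_cancel (x 1)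
      · change -x 2 + x 0 * x 1 + x 2 + -x 0 * x 1 = 0
        ring
      · exact neg_add_cancel (x 3)
      · exact neg_add_cancel (x 4)
      · change -x 5 + x 3 * x 4 + x 5 + -x 3 * x 4 = 0
        ring
      · exact neg_add_cancel (x 6)
      · exact neg_add_cancel (x 7))

/-- The upper unitriangular matrix with the Heisenberg coordinates `(a, b, c)`. -/
def heisenbergMatrix (a b c : ℝ) : Matrix (Fin 3) (Fin 3) ℝ :=
  !![1, a, c; 0, 1, b; 0, 0, 1]

/-- The group law is the one of the product of two Heisenberg groups of unitriangular real
`3 × 3` matrices and of the additive group `ℝ²`. -/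
theorem mul_eq_product_law (x y : NilGroup) :
    heisenbergMatrix ((x * y) 0) ((x * y) 1) ((x * y) 2) =
        heisenbergMatrix (x 0) (x 1) (x 2) * heisenbergMatrix (y 0) (y 1) (y 2) ∧
      heisenbergMatrix ((x * y) 3) ((x * y) 4) ((x * y) 5) =
        heisenbergMatrix (x 3) (x 4) (x 5) * heisenbergMatrix (y 3) (y 4) (y 5) ∧
      (x * y) 6 = x 6 + y 6 ∧ (x * y) 7 = x 7 + y 7 := by
  have h2 : (x * y) 2 = x 2 + y 2 + x 0 * y 1 := rfl
  have h5 : (x * y) 5 = x 5 + y 5 + x 3 * y 4 := rfl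
  have h0 : (x * y) 0 = x 0 + y 0 := rfl
  have h1 : (x * y) 1 = x 1 + y 1 := rfl
  have h3 : (x * y) 3 = x 3 + y 3 := rfl
  have h4 : (x * y) 4 = x 4 + y 4 := rfl
  refine ⟨?_, ?_, rfl, rfl⟩ <;>
  · ext i j
    fin_cases i <;> fin_cases j <;>
      simp [heisenbergMatrix, h0, h1, h2, h3, h4, h5, Matrix.mul_apply, Fin.sum_univ_three] <;>
      ring

/-- Left translation `x ↦ g x`, in coordinates. -/
def leftTranslation (g : NilGroup) : CoordSpace → CoordSpace :=
  fun x => (g * (show NilGroup from x) : NilGroup)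

end NilGroup

/-! ## Differential forms on `M = Γ \ G` -/

/-- The complexified cotangent space (in the global coordinates, the same at each point). -/
abbrev Covector : Type := CoordSpace →L[ℝ] ℂ

/-- Complex valued alternating `k`-covectors. -/
abbrev KCovector (k : ℕ) : Type := CoordSpace [⋀^Fin k]→L[ℝ] ℂ

/-- Complex conjugate of a complex covector. -/
noncomputable def Covector.conj (l : Covector) : Covector :=
  (Complex.conjCLE : ℂ →L[ℝ] ℂ).comp l

/-- The wedge product `l₁ ∧ ⋯ ∧ l_k` of covectors, with
`(l₁ ∧ ⋯ ∧ l_k) (v₁, …, v_k) = det (l_i (v_j))`. -/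
noncomputable def wedge {k : ℕ} (l : Fin k → Covector) : KCovector k :=
  ContinuousMultilinearMap.alternatization
    ((ContinuousMultilinearMap.mkPiAlgebra ℝ (Fin k) ℂ).compContinuousLinearMap l)

theorem wedge_apply {k : ℕ} (l : Fin k → Covector) (v : Fin k → CoordSpace) :
    wedge l v = Matrix.det (Matrix.of fun i j => l i (v j)) := by
  rw [wedge, ContinuousMultilinearMap.alternatization_apply_apply, ← Matrix.det_transpose,
    Matrix.det_apply]
  simp

/-- A covector, seen as a `1`-covector. -/
noncomputable def Covector.toOne (l : Covector) : KCovector 1 :=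
  ContinuousAlternatingMap.ofSubsingleton ℝ CoordSpace ℂ 0 l

/-- `𝒜ᵏ(M)`: the smooth complex `k`-forms on `M = Γ \ G`, that is, the smooth `k`-forms `α` on the
covering group `G` with `L_γ^* α = α` for all `γ ∈ Γ`. -/
def formsOn (Γ : Subgroup NilGroup) (k : ℕ) : Submodule ℂ (CoordSpace → KCovector k) where
  carrier := {α | ContDiff ℝ ∞ α ∧ ∀ γ ∈ Γ, ∀ x,
    (α (NilGroup.leftTranslation γ x)).compContinuousLinearMap
      (fderiv ℝ (NilGroup.leftTranslation γ) x) = α x}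
  add_mem' := by
    rintro α β ⟨hα, hα'⟩ ⟨hβ, hβ'⟩
    refine ⟨hα.add hβ, fun γ hγ x => ?_⟩
    rw [Pi.add_apply α β x, ← hα' γ hγ x, ← hβ' γ hγ x]
    rfl
  zero_mem' := ⟨contDiff_const, fun _ _ _ => rfl⟩
  smul_mem' := by
    rintro c α ⟨hα, hα'⟩
    refine ⟨hα.const_smul c, fun γ hγ x => ?_⟩
    rw [Pi.smul_apply c α x, ← hα' γ hγ x]
    rfl

/-! ## Invariant coframes, almost complex structures and types -/

/-- Four complex `1`-forms on `G`. -/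
abbrev FormQuadruple : Type := Fin 4 → CoordSpace → Covector

/-- At each point, the four forms and their conjugates are linearly independent, so that they are
the `(1,0)`-coframe of a unique almost complex structure. -/
def IsCoframe (θ : FormQuadruple) : Prop :=
  ∀ x, LinearIndependent ℂ
    (Sum.elim (fun j => θ j x) (fun j => (θ j x).conj) : Fin 4 ⊕ Fin 4 → Covector)

/-- The four forms are smooth and left-invariant on `G`. -/
def IsLeftInvariant (θ : FormQuadruple) : Prop :=
  ∀ j, ContDiff ℝ ∞ (θ j) ∧ ∀ (g : NilGroup) (x : CoordSpace),
    (θ j (NilGroup.leftTranslation g x)).comp (fderiv ℝ (NilGroup.leftTranslation g) x) = θ j x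

/-- The structure equations `dη¹ = dη² = 0`, `dη³ = κ η¹ ∧ η̄¹`, `dη⁴ = κ η² ∧ η̄²`. -/
def StructureEquations (κ : ℂ) (η : FormQuadruple) : Prop :=
  ∀ x, extDeriv (fun y => (η 0 y).toOne) x = 0 ∧
    extDeriv (fun y => (η 1 y).toOne) x = 0 ∧
    extDeriv (fun y => (η 2 y).toOne) x = κ • wedge ![η 0 x, (η 0 x).conj] ∧
    extDeriv (fun y => (η 3 y).toOne) x = κ • wedge ![η 1 x, (η 1 x).conj]

/-- The covectors of type `(p,q)` at `x`, for the almost complex structure with `(1,0)`-coframe `θ`: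
the span of the wedge products of `p` of the `θʲ` and `q` of their conjugates. -/
noncomputable def typeCovectors (θ : FormQuadruple) (k p q : ℕ) (x : CoordSpace) :
    Submodule ℂ (KCovector k) :=
  Submodule.span ℂ {β | ∃ (s : Fin k → Bool) (J : Fin k → Fin 4),
    (Finset.univ.filter fun i => s i = true).card = p ∧
    (Finset.univ.filter fun i => s i = false).card = q ∧
    β = wedge fun i => if s i then θ (J i) x else (θ (J i) x).conj}

/-- `𝒜^{p,q}`: the forms of type `(p,q)` on `M = Γ \ G` (inside `𝒜ᵏ(M)`; here `k = p + q`, and the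
space is zero otherwise), for the almost complex structure with `(1,0)`-coframe `θ`. -/
noncomputable def typeForms (Γ : Subgroup NilGroup) (θ : FormQuadruple) (k p q : ℕ) :
    Submodule ℂ (CoordSpace → KCovector k) where
  carrier := {α | α ∈ formsOn Γ k ∧ ∀ x, α x ∈ typeCovectors θ k p q x}
  add_mem' := fun hα hβ => ⟨add_mem hα.1 hβ.1, fun x => add_mem (hα.2 x) (hβ.2 x)⟩
  zero_mem' := ⟨zero_mem _, fun _ => zero_mem _⟩
  smul_mem' := fun c _ hα =>
    ⟨Submodule.smul_mem _ c hα.1, fun x => Submodule.smul_mem _ c (hα.2 x)⟩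

open Classical in
/-- The projection `π^{p,q}` onto `𝒜^{p,q}` for the decomposition of `𝒜ᵏ(M)` into the direct sum of
the spaces `𝒜^{r,s}`, `r + s = k`. -/
noncomputable def typeProjection (Γ : Subgroup NilGroup) (θ : FormQuadruple) {k : ℕ} (p q : ℕ)
    (α : CoordSpace → KCovector k) : CoordSpace → KCovector k :=
  if h : ∃ β, β ∈ typeForms Γ θ k p q ∧
      α - β ∈ ⨆ r : ℕ × ℕ, ⨆ _ : r ≠ (p, q), typeForms Γ θ k r.1 r.2
  then h.choose else 0

/-- `∂ = π^{p+1,q} ∘ d` on forms of type `(p,q)`. -/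
noncomputable def del (Γ : Subgroup NilGroup) (θ : FormQuadruple) {k : ℕ} (p q : ℕ)
    (α : CoordSpace → KCovector k) : CoordSpace → KCovector (k + 1) :=
  typeProjection Γ θ (p + 1) q (extDeriv α)

/-- `∂̄ = π^{p,q+1} ∘ d` on forms of type `(p,q)`. -/
noncomputable def delbar (Γ : Subgroup NilGroup) (θ : FormQuadruple) {k : ℕ} (p q : ℕ)
    (α : CoordSpace → KCovector k) : CoordSpace → KCovector (k + 1) :=
  typeProjection Γ θ p (q + 1) (extDeriv α)

/-- The SKT (strong Kähler with torsion) condition `∂ ∂̄ ω = 0` for a `(1,1)`-form on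
`M = Γ \ G` with the complex structure whose `(1,0)`-coframe is `θ`. -/
def IsSKT (Γ : Subgroup NilGroup) (θ : FormQuadruple) (Ω : CoordSpace → KCovector 2) : Prop :=
  Ω ∈ typeForms Γ θ 2 1 1 ∧ del Γ θ 1 2 (delbar Γ θ 1 1 Ω) = 0

/-! ## Deformations and Hermitian metrics -/

/-- For the invariant vector form `φ = ∑ A_{jk} η̄ᵏ ⊗ Z_j`, with `Z_j` the frame dual to `ηʲ`:
the forms `e^{i_φ}(ηʲ) = ηʲ + i_φ ηʲ = ηʲ + ∑ₖ A_{jk} η̄ᵏ`. They are the `(1,0)`-coframe of the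
complex structure that `φ` parametrizes. -/
noncomputable def deform (A : Matrix (Fin 4) (Fin 4) ℂ) (η : FormQuadruple) : FormQuadruple :=
  fun j x => η j x + ∑ k, A j k • (η k x).conj

/-- The form `e^{i_φ | i_φ̄}(ω)`, where
`ω = (i/2) ∑ⱼ α_{jj̄} ηʲ∧η̄ʲ + (1/2) ∑_{j<k} (α_{jk̄} ηʲ∧η̄ᵏ - conj α_{jk̄} ηᵏ∧η̄ʲ)`
and `θ` is the quadruple of the forms `e^{i_φ}(ηʲ)`: the extension map replaces each `ηʲ` by
`e^{i_φ}(ηʲ)` and each `η̄ᵏ` by `e^{i_φ̄}(η̄ᵏ)`, the conjugate of `e^{i_φ}(ηᵏ)`. -/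
noncomputable def fundamentalForm (θ : FormQuadruple) (α : Fin 4 → Fin 4 → ℂ) :
    CoordSpace → KCovector 2 :=
  fun x => (I / 2) • ∑ j, α j j • wedge ![θ j x, (θ j x).conj] +
    (1 / 2 : ℂ) • ∑ j, ∑ k ∈ Finset.Ioi j,
      (α j k • wedge ![θ j x, (θ k x).conj] -
        (starRingEnd ℂ) (α j k) • wedge ![θ k x, (θ j x).conj])

/-- The matrix of the metric with the coefficients `α_{jk̄}`, `j ≤ k`: the diagonal entries are
`α_{jj̄}`, the entries above it `-i α_{jk̄}`, the entries below it their conjugates. -/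
noncomputable def metricMatrix (α : Fin 4 → Fin 4 → ℂ) : Matrix (Fin 4) (Fin 4) ℂ :=
  Matrix.of fun j k =>
    if j = k then α j j else if j < k then -I * α j k else I * (starRingEnd ℂ) (α k j)

/-! ## The standard coframe: the conditions on the coframe can be satisfied -/

/-- The invariant coframe `η¹ = dx¹ + i dx²`, `η² = dx⁴ + i dx⁵`,
`η³ = 2κ (dx⁷ + i (dx³ - x¹ dx²))`, `η⁴ = 2κ (dx⁸ + i (dx⁶ - x⁴ dx⁵))`. -/
noncomputable def standardCoframe (κ : ℂ) : FormQuadruple :=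
  let dx (i : Fin 8) : Covector := Complex.ofRealCLM.comp (ContinuousLinearMap.proj i)
  ![fun _ => dx 0 + I • dx 1,
    fun _ => dx 3 + I • dx 4,
    fun x => (2 * κ) • (dx 6 + I • (dx 2 - x 0 • dx 1)),
    fun x => (2 * κ) • (dx 7 + I • (dx 5 - x 3 • dx 4))]

/-- The linear part of a left translation, which is affine in the coordinates. -/
noncomputable def leftTranslationLinear (g : NilGroup) : CoordSpace →L[ℝ] CoordSpace :=
  let dx (i : Fin 8) : CoordSpace →L[ℝ] ℝ := ContinuousLinearMap.proj i
  ContinuousLinearMap.pi ![dx 0, dx 1, dx 2 + g 0 • dx 1, dx 3, dx 4, dx 5 + g 3 • dx 4, dx 6, dx 7]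

theorem hasFDerivAt_leftTranslation (g : NilGroup) (x : CoordSpace) :
    HasFDerivAt (NilGroup.leftTranslation g) (leftTranslationLinear g) x := by
  have : NilGroup.leftTranslation g = fun x => leftTranslationLinear g x + (show CoordSpace from g) := by
    funext x i
    fin_cases i <;> simp [leftTranslationLinear]
    · exact add_comm _ _
    · exact add_comm _ _
    · change g 2 + x 2 + g 0 * x 1 = x 2 + g 0 * x 1 + g 2
      ring
    · exact add_comm _ _
    · exact add_comm _ _
    · change g 5 + x 5 + g 3 * x 4 = x 5 + g 3 * x 4 + g 5
      ring
    · exact add_comm _ _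
    · exact add_comm _ _
  rw [this]
  exact (leftTranslationLinear g).hasFDerivAt.add_const _

theorem standardCoframe_isLeftInvariant (κ : ℂ) : IsLeftInvariant (standardCoframe κ) := by
  intro j
  constructor
  · fin_cases j <;> simp only [standardCoframe] <;> simp <;> fun_prop
  · intro g x
    rw [(hasFDerivAt_leftTranslation g x).fderiv]
    have h0 : NilGroup.leftTranslation g x 0 = g 0 + x 0 := rfl
    have h3 : NilGroup.leftTranslation g x 3 = g 3 + x 3 := rfl
    ext v
    fin_cases j <;> simp [standardCoframe, leftTranslationLinear, h0, h3] <;> left <;> ring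

theorem standardCoframe_isCoframe (κ : ℂ) (hκ : κ ≠ 0) : IsCoframe (standardCoframe κ) := by
  intro x
  rw [Fintype.linearIndependent_iff]
  intro c hc
  have key (v : CoordSpace) := congrArg (fun l : Covector => l v) hc
  simp [Fin.sum_univ_four, standardCoframe, Covector.conj] at key
  have e (i : Fin 8) := key (Pi.single i 1)
  have e0 := e 0
  have e1 := e 1
  have e2 := e 2
  have e3 := e 3
  have e4 := e 4
  have e5 := e 5
  have e6 := e 6
  have e7 := e 7
  simp at e0 e1 e2 e3 e4 e5 e6 e7
  clear e key hc
  have c2 : (starRingEnd ℂ) 2 = 2 := map_ofNat _ 2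
  simp only [c2] at e0 e1 e2 e3 e4 e5 e6 e7
  have hk : (starRingEnd ℂ) κ ≠ 0 := by simpa using hκ
  have aux : ∀ a b : ℂ, a + b = 0 → a * I - b * I = 0 → a = 0 ∧ b = 0 := by
    intro a b h1 h2
    have : a = b := by
      have h3 : (a - b) * I = 0 := by linear_combination h2
      simpa [sub_eq_zero] using h3
    subst this
    have : a = 0 := by linear_combination h1 / 2
    exact ⟨this, this⟩
  have r2 := aux (c (Sum.inl 2) * κ) (c (Sum.inr 2) * (starRingEnd ℂ) κ)
    (by linear_combination e6 / 2) (by linear_combination e2 / 2)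
  have r3 := aux (c (Sum.inl 3) * κ) (c (Sum.inr 3) * (starRingEnd ℂ) κ)
    (by linear_combination e7 / 2) (by linear_combination e5 / 2)
  have r0 := aux (c (Sum.inl 0)) (c (Sum.inr 0)) e0
    (by linear_combination e1 + 2 * x 0 * I * r2.1 - 2 * x 0 * I * r2.2)
  have r1 := aux (c (Sum.inl 1)) (c (Sum.inr 1)) e3
    (by linear_combination e4 + 2 * x 3 * I * r3.1 - 2 * x 3 * I * r3.2)
  simp [hκ] at r2 r3
  rintro (j | j) <;> fin_cases j <;> simp [r0, r1, r2, r3]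

theorem extDeriv_affine_apply (K D : Covector) (i : Fin 8) (x : CoordSpace) (v : Fin 2 → CoordSpace) :
    extDeriv (fun y : CoordSpace => (K + y i • D).toOne) x v = v 0 i * D (v 1) - v 1 i * D (v 0) := by
  have h : HasFDerivAt (fun y : CoordSpace => (K + y i • D).toOne)
      ((ContinuousLinearMap.proj i : CoordSpace →L[ℝ] ℝ).smulRight D.toOne) x := by
    have : (fun y : CoordSpace => (K + y i • D).toOne) = fun y => K.toOne +
      ((ContinuousLinearMap.proj i : CoordSpace →L[ℝ] ℝ).smulRight D.toOne) y := by
      funext y; ext v; simp [Covector.toOne]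
    rw [this]
    exact (ContinuousLinearMap.hasFDerivAt _).const_add _
  rw [extDeriv, h.fderiv, ContinuousAlternatingMap.alternatizeUncurryFin_apply]
  simp [Fin.sum_univ_two, Covector.toOne, Fin.removeNth]
  ring

theorem standardCoframe_structureEquations (κ : ℂ) : StructureEquations κ (standardCoframe κ) := by
  intro x
  refine ⟨?_, ?_, ?_, ?_⟩
  · ext v
    have h : standardCoframe κ 0 = fun y => standardCoframe κ 0 x + y 0 • (0 : Covector) := by
      funext y; ext v; simp [standardCoframe]
    rw [h, extDeriv_affine_apply]
    simp
  · ext v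
    have h : standardCoframe κ 1 = fun y => standardCoframe κ 1 x + y 0 • (0 : Covector) := by
      funext y; ext v; simp [standardCoframe]
    rw [h, extDeriv_affine_apply]
    simp
  · have h : standardCoframe κ 2 = fun y => standardCoframe κ 2 0 +
      y 0 • (-(2 * κ * I) • (Complex.ofRealCLM.comp (ContinuousLinearMap.proj 1 : CoordSpace →L[ℝ] ℝ))) := by
      funext y; ext v; simp [standardCoframe]; ring
    ext v
    rw [h, extDeriv_affine_apply]
    simp [wedge_apply, Matrix.det_fin_two, standardCoframe, Covector.conj]
    ring
  · have h : standardCoframe κ 3 = fun y => standardCoframe κ 3 0 +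
      y 3 • (-(2 * κ * I) • (Complex.ofRealCLM.comp (ContinuousLinearMap.proj 4 : CoordSpace →L[ℝ] ℝ))) := by
      funext y; ext v; simp [standardCoframe]; ring
    ext v
    rw [h, extDeriv_affine_apply]
    simp [wedge_apply, Matrix.det_fin_two, standardCoframe, Covector.conj]
    ring

/-! ## Wedge products of covectors -/

/-! The SKT condition collapses to one scalar equation in `t`, and the result is its first
derivative at `t = 0`.

Write `θ` for the deformed coframe and `P` for `deformCoeff`, so that `dθʲ = P j 0 η¹∧η̄¹ + P j 1
η²∧η̄²` (`extDeriv_deform`). The first two forms are `θ¹ = η¹ + t a₁₁ η̄¹` and `θ² = η² + t a₂₂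
η̄²`, hence `θ¹∧θ̄¹ = (1 - |t a₁₁|²) η¹∧η̄¹`, and similarly for `θ²`. The factors are nonzero
because `θ` is a coframe. So `η¹∧η̄¹` and `η²∧η̄²` are closed and of type (1,1) for the deformed
structure as well.

For `Ω = ∑ c_{jk} θʲ∧θ̄ᵏ` the form `∂̄Ω` is therefore `∑ c_{jk} dθʲ∧θ̄ᵏ`. Its differential is a
multiple of `η¹∧η̄¹∧η²∧η̄²`, already of type (2,2), so it equals `∂∂̄Ω`. That 4-form does not
vanish, so the multiple must (`sum_eq_zero_of_isSKT`).

Only `θ³` and `θ⁴` have nonzero differentials, and the equation reads `|κ|² (α₃₄ - conj α₃₄) + t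
G(t) = 0` (`scalar_eq_zero`). Differentiating at 0 gives `|κ|² · 2i Im α₃₄'(0) + G(0) = 0`
(`deriv_sub_conj_add_eq_zero`). If `κ` is real or purely imaginary, then `κ̄² = κ²` and `G(0) = -κ²
L`, while `|κ|²` is `κ²` or `-κ²`; this is the sign in the two cases.

The projections in `∂` and `∂̄` are given by a choice, so the uniqueness of type components has to
be proved (`disjoint_typeForms`). Existence is not needed in general, since the components of the
forms at hand are explicit. -/

theorem wedge_compContinuousLinearMap {k : ℕ} (l : Fin k → Covector)
    (f : CoordSpace →L[ℝ] CoordSpace) :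
    (wedge l).compContinuousLinearMap f = wedge fun i => (l i).comp f := by
  ext v
  simp only [ContinuousAlternatingMap.compContinuousLinearMap_apply, wedge_apply]
  rfl

/-- The alternatization of continuous multilinear maps, as a continuous linear map. -/
noncomputable def alternatizationCLM (k : ℕ) :
    ContinuousMultilinearMap ℝ (fun _ : Fin k => CoordSpace) ℂ →L[ℝ] KCovector k :=
  LinearMap.mkContinuous
    { toFun := ContinuousMultilinearMap.alternatization
      map_add' := map_add _
      map_smul' := fun c f => by
        ext v
        simp [ContinuousMultilinearMap.alternatization_apply_apply, Finset.mul_sum,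
          mul_smul_comm] }
    (Fintype.card (Equiv.Perm (Fin k))) fun f => by
      refine ContinuousAlternatingMap.opNorm_le_bound _ (by positivity) fun v => ?_
      change ‖ContinuousMultilinearMap.alternatization f v‖ ≤ _
      rw [ContinuousMultilinearMap.alternatization_apply_apply]
      refine (norm_sum_le _ _).trans ?_
      rw [mul_assoc, ← nsmul_eq_mul]
      refine Finset.sum_le_card_nsmul _ _ _ fun τ _ => ?_
      have h : ‖Equiv.Perm.sign τ • f (v ∘ τ)‖ = ‖f (v ∘ τ)‖ := by
        rcases Int.units_eq_one_or (Equiv.Perm.sign τ) with h | h <;> simp [h]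
      rw [h, ← Equiv.prod_comp τ fun i => ‖v i‖]
      exact f.le_opNorm _

/-- The wedge product is a continuous multilinear map of the covectors followed by the continuous
linear alternatization. This gives the smoothness half of membership in `formsOn`. -/
theorem contDiff_wedge {k : ℕ} {n : WithTop ℕ∞} {σ : Fin k → CoordSpace → Covector}
    (h : ∀ i, ContDiff ℝ n (σ i)) : ContDiff ℝ n fun x => wedge fun i => σ i x := by
  have h1 : ContDiff ℝ n fun x => (fun i => σ i x) := contDiff_pi.2 h
  have h2 : ContDiff ℝ n fun x =>
      (ContinuousMultilinearMap.mkPiAlgebra ℝ (Fin k) ℂ).compContinuousLinearMap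
        fun i => σ i x :=
    ((ContinuousMultilinearMap.compContinuousLinearMapContinuousMultilinear ℝ
        (fun _ : Fin k => CoordSpace) (fun _ : Fin k => ℂ) ℂ).contDiff.comp h1).clm_apply
      contDiff_const
  exact (alternatizationCLM k).contDiff.comp h2

theorem contDiff_wedge_two {n : WithTop ℕ∞} {a b : CoordSpace → Covector} (ha : ContDiff ℝ n a)
    (hb : ContDiff ℝ n b) : ContDiff ℝ n fun y => wedge ![a y, b y] := by
  have := contDiff_wedge (σ := ![a, b]) (n := n) (by intro i; fin_cases i <;> assumption)
  convert this using 3 with y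
  funext i; fin_cases i <;> rfl

theorem contDiff_wedge_three {n : WithTop ℕ∞} {a b c : CoordSpace → Covector}
    (ha : ContDiff ℝ n a) (hb : ContDiff ℝ n b) (hc : ContDiff ℝ n c) :
    ContDiff ℝ n fun y => wedge ![a y, b y, c y] := by
  have := contDiff_wedge (σ := ![a, b, c]) (n := n) (by intro i; fin_cases i <;> assumption)
  convert this using 3 with y
  funext i; fin_cases i <;> rfl

theorem Covector.zero_smul (a : Covector) : (0 : ℂ) • a = 0 := _root_.zero_smul ℂ a

theorem KCovector.zero_smul {k : ℕ} (β : KCovector k) : (0 : ℂ) • β = 0 := _root_.zero_smul ℂ β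

theorem wedge_two_apply (a b : Covector) (v : Fin 2 → CoordSpace) :
    wedge ![a, b] v = a (v 0) * b (v 1) - a (v 1) * b (v 0) := by
  simp [wedge_apply, Matrix.det_fin_two]

theorem wedge_three_apply (a b c : Covector) (v : Fin 3 → CoordSpace) :
    wedge ![a, b, c] v = a (v 0) * b (v 1) * c (v 2) - a (v 0) * b (v 2) * c (v 1)
      - a (v 1) * b (v 0) * c (v 2) + a (v 1) * b (v 2) * c (v 0)
      + a (v 2) * b (v 0) * c (v 1) - a (v 2) * b (v 1) * c (v 0) := by
  simp [wedge_apply, Matrix.det_fin_three]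

theorem wedge_four_apply (a b c d : Covector) (v : Fin 4 → CoordSpace) :
    wedge ![a, b, c, d] v =
      a (v 0) * wedge ![b, c, d] ![v 1, v 2, v 3] - a (v 1) * wedge ![b, c, d] ![v 0, v 2, v 3]
        + a (v 2) * wedge ![b, c, d] ![v 0, v 1, v 3]
        - a (v 3) * wedge ![b, c, d] ![v 0, v 1, v 2] := by
  simp only [wedge_three_apply]
  simp [wedge_apply, Matrix.det_succ_row_zero (n := 3), Matrix.det_fin_three, Fin.succAbove,
    Fin.sum_univ_four]
  ring

@[simp] theorem Covector.conj_apply (a : Covector) (v : CoordSpace) :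
    a.conj v = (starRingEnd ℂ) (a v) := rfl

@[simp] theorem Covector.conj_conj (a : Covector) : a.conj.conj = a := by
  ext v; simp

/-! ## Left-invariant forms -/

/-- A smooth left-invariant complex `1`-form on the group. -/
def IsInvariantForm (σ : CoordSpace → Covector) : Prop :=
  ContDiff ℝ ∞ σ ∧ ∀ (g : NilGroup) (x : CoordSpace),
    (σ (NilGroup.leftTranslation g x)).comp (fderiv ℝ (NilGroup.leftTranslation g) x) = σ x

namespace IsInvariantForm

variable {a b : CoordSpace → Covector}

theorem differentiable (ha : IsInvariantForm a) : Differentiable ℝ a :=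
  ha.1.differentiable (by simp)

theorem conj (ha : IsInvariantForm a) : IsInvariantForm fun x => (a x).conj := by
  refine ⟨contDiff_const.clm_comp ha.1, fun g x => ?_⟩
  simp only [← ha.2 g x]
  rfl

theorem add (ha : IsInvariantForm a) (hb : IsInvariantForm b) :
    IsInvariantForm fun x => a x + b x := by
  refine ⟨ha.1.add hb.1, fun g x => ?_⟩
  simp only [← ha.2 g x, ← hb.2 g x]
  rfl

theorem const_smul (c : ℂ) (ha : IsInvariantForm a) : IsInvariantForm fun x => c • a x := by
  refine ⟨ha.1.const_smul c, fun g x => ?_⟩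
  simp only [← ha.2 g x]
  rfl

theorem sum {ι : Type*} (s : Finset ι) {a : ι → CoordSpace → Covector}
    (ha : ∀ i, IsInvariantForm (a i)) : IsInvariantForm fun x => ∑ i ∈ s, a i x := by
  classical
  induction s using Finset.induction_on with
  | empty =>
    simp only [Finset.sum_empty]
    exact ⟨contDiff_const, fun _ _ => rfl⟩
  | insert i s hi ih =>
    simp only [Finset.sum_insert hi]
    exact (ha i).add ih

theorem wedge_mem_formsOn {k : ℕ} (Γ : Subgroup NilGroup) {σ : Fin k → CoordSpace → Covector}
    (h : ∀ i, IsInvariantForm (σ i)) : (fun x => wedge fun i => σ i x) ∈ formsOn Γ k := by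
  refine ⟨contDiff_wedge fun i => (h i).1, fun γ _ x => ?_⟩
  rw [wedge_compContinuousLinearMap]
  congr 1
  funext i
  exact (h i).2 γ x

end IsInvariantForm

/-! ## Exterior derivatives -/

theorem extDeriv_const_smul_complex {k : ℕ} (c : ℂ) {α : CoordSpace → KCovector k}
    {x : CoordSpace} (h : DifferentiableAt ℝ α x) :
    extDeriv (fun y => c • α y) x = c • extDeriv α x := by
  ext v
  rw [extDeriv, extDeriv, fderiv_fun_const_smul h]
  simp [ContinuousAlternatingMap.alternatizeUncurryFin_apply,
    Finset.mul_sum]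

theorem extDeriv_sum {k : ℕ} {ι : Type*} (s : Finset ι) {α : ι → CoordSpace → KCovector k}
    {x : CoordSpace} (h : ∀ i, DifferentiableAt ℝ (α i) x) :
    extDeriv (fun y => ∑ i ∈ s, α i y) x = ∑ i ∈ s, extDeriv (α i) x := by
  ext v
  rw [extDeriv, fderiv_fun_sum fun i _ => h i]
  simp only [extDeriv, ContinuousAlternatingMap.alternatizeUncurryFin_apply,
    ContinuousAlternatingMap.sum_apply, sum_apply, Finset.smul_sum]
  exact Finset.sum_comm

section

variable {a b c : CoordSpace → Covector} {x : CoordSpace}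

theorem extDeriv_toOne_apply (ha : DifferentiableAt ℝ a x) (v : Fin 2 → CoordSpace) :
    extDeriv (fun y => (a y).toOne) x v = fderiv ℝ a x (v 0) (v 1) - fderiv ℝ a x (v 1) (v 0) := by
  have h : DifferentiableAt ℝ (fun y => (a y).toOne) x :=
    (ContinuousAlternatingMap.ofSubsingletonLIE (𝕜 := ℝ) (E := CoordSpace) (F := ℂ)
      (0 : Fin 1)).differentiableAt.comp
      x ha
  rw [extDeriv_apply h]
  simp [Fin.sum_univ_two, Covector.toOne, Fin.removeNth,
    fderiv_clm_apply ha (differentiableAt_const _)]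
  ring

theorem hasFDerivAt_covector_apply (ha : DifferentiableAt ℝ a x) (w : CoordSpace) :
    HasFDerivAt (fun y => a y w) ((fderiv ℝ a x).flip w) x := by
  simpa using ha.hasFDerivAt.clm_apply (hasFDerivAt_const w x)

theorem extDeriv_wedge_two_apply (ha : ContDiff ℝ ∞ a) (hb : ContDiff ℝ ∞ b)
    (v : Fin 3 → CoordSpace) :
    extDeriv (fun y => wedge ![a y, b y]) x v =
      (extDeriv (fun y => (a y).toOne) x ![v 0, v 1] * b x (v 2)
        - extDeriv (fun y => (a y).toOne) x ![v 0, v 2] * b x (v 1)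
        + extDeriv (fun y => (a y).toOne) x ![v 1, v 2] * b x (v 0))
      - (a x (v 0) * extDeriv (fun y => (b y).toOne) x ![v 1, v 2]
        - a x (v 1) * extDeriv (fun y => (b y).toOne) x ![v 0, v 2]
        + a x (v 2) * extDeriv (fun y => (b y).toOne) x ![v 0, v 1]) := by
  have ha' := ha.differentiable (by simp) x
  have hb' := hb.differentiable (by simp) x
  have hw := contDiff_wedge_two ha hb
  have key (p q u : CoordSpace) : fderiv ℝ (fun y => a y p * b y q - a y q * b y p) x u =
      a x p * fderiv ℝ b x u q + fderiv ℝ a x u p * b x q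
        - a x q * fderiv ℝ b x u p - fderiv ℝ a x u q * b x p := by
    refine (DFunLike.congr_fun (((hasFDerivAt_covector_apply ha' p).mul
      (hasFDerivAt_covector_apply hb' q)).sub ((hasFDerivAt_covector_apply ha' q).mul
      (hasFDerivAt_covector_apply hb' p))).fderiv u).trans ?_
    simp
    ring
  refine (extDeriv_apply (hw.differentiable (by simp) x) v).trans
    ((Fin.sum_univ_three _).trans ?_)
  simp only [extDeriv_toOne_apply ha', extDeriv_toOne_apply hb', wedge_two_apply, key]
  simp [Fin.removeNth, Fin.succAbove]
  ring

/-- With `a` and `b` closed, the Leibniz rule leaves only `a∧b∧dc`, here expanded over the six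
(2,2)-shuffles. Closedness enters as the symmetry of the derivatives of `a` and `b`, which cancels
their terms in the alternating sum. -/
theorem extDeriv_wedge_three_apply (ha : ContDiff ℝ ∞ a) (hb : ContDiff ℝ ∞ b)
    (hc : ContDiff ℝ ∞ c) (hda : extDeriv (fun y => (a y).toOne) x = 0)
    (hdb : extDeriv (fun y => (b y).toOne) x = 0) (v : Fin 4 → CoordSpace) :
    extDeriv (fun y => wedge ![a y, b y, c y]) x v =
      wedge ![a x, b x] ![v 0, v 1] * extDeriv (fun y => (c y).toOne) x ![v 2, v 3]
      - wedge ![a x, b x] ![v 0, v 2] * extDeriv (fun y => (c y).toOne) x ![v 1, v 3]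
      + wedge ![a x, b x] ![v 0, v 3] * extDeriv (fun y => (c y).toOne) x ![v 1, v 2]
      + wedge ![a x, b x] ![v 1, v 2] * extDeriv (fun y => (c y).toOne) x ![v 0, v 3]
      - wedge ![a x, b x] ![v 1, v 3] * extDeriv (fun y => (c y).toOne) x ![v 0, v 2]
      + wedge ![a x, b x] ![v 2, v 3] * extDeriv (fun y => (c y).toOne) x ![v 0, v 1] := by
  have ha' := ha.differentiable (by simp) x
  have hb' := hb.differentiable (by simp) x
  have hc' := hc.differentiable (by simp) x
  have hw := contDiff_wedge_three ha hb hc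
  have hsa (p q : CoordSpace) : fderiv ℝ a x p q = fderiv ℝ a x q p := by
    have := extDeriv_toOne_apply ha' ![p, q]
    rw [hda] at this
    simpa [sub_eq_zero] using this.symm
  have hsb (p q : CoordSpace) : fderiv ℝ b x p q = fderiv ℝ b x q p := by
    have := extDeriv_toOne_apply hb' ![p, q]
    rw [hdb] at this
    simpa [sub_eq_zero] using this.symm
  have triple (p q r : CoordSpace) : HasFDerivAt (fun y => a y p * b y q * c y r)
      ((a x p * b x q) • (fderiv ℝ c x).flip r + c x r • (a x p • (fderiv ℝ b x).flip q
        + b x q • (fderiv ℝ a x).flip p)) x :=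
    ((hasFDerivAt_covector_apply ha' p).mul (hasFDerivAt_covector_apply hb' q)).mul (hasFDerivAt_covector_apply hc' r)
  have key (p q r u : CoordSpace) : fderiv ℝ (fun y => wedge ![a y, b y, c y] ![p, q, r]) x u =
      wedge ![fderiv ℝ a x u, b x, c x] ![p, q, r] + wedge ![a x, fderiv ℝ b x u, c x] ![p, q, r]
        + wedge ![a x, b x, fderiv ℝ c x u] ![p, q, r] := by
    simp only [wedge_three_apply]
    refine (DFunLike.congr_fun ((((((triple p q r).sub (triple p r q)).sub
      (triple q p r)).add (triple q r p)).add (triple r p q)).sub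
      (triple r q p)).fderiv u).trans ?_
    simp
    ring
  have hrem (i : Fin 4) : i.removeNth v = ![i.removeNth v 0, i.removeNth v 1, i.removeNth v 2] := by
    funext j; fin_cases j <;> rfl
  refine (extDeriv_apply (hw.differentiable (by simp) x) v).trans
    ((Fin.sum_univ_four _).trans ?_)
  rw [hrem 0, hrem 1, hrem 2, hrem 3]
  simp only [key]
  simp only [extDeriv_toOne_apply hc', wedge_two_apply, wedge_three_apply]
  simp [Fin.removeNth, Fin.succAbove]
  rw [hsa (v 1) (v 0), hsa (v 2) (v 0), hsa (v 3) (v 0), hsa (v 2) (v 1), hsa (v 3) (v 1),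
    hsa (v 3) (v 2), hsb (v 1) (v 0), hsb (v 2) (v 0), hsb (v 3) (v 0), hsb (v 2) (v 1),
    hsb (v 3) (v 1), hsb (v 3) (v 2)]
  ring

end

/-! ## Coframes and the decomposition into types -/

theorem wedge_smul {k : ℕ} (m : Fin k → ℂ) (l : Fin k → Covector) :
    wedge (fun i => m i • l i) = (∏ i, m i) • wedge l := by
  ext v
  rw [wedge_apply, ContinuousAlternatingMap.smul_apply, wedge_apply, smul_eq_mul,
    ← Matrix.det_mul_column]
  rfl

/-- Four covectors that together with their conjugates are linearly independent identify the
real coordinate space with `ℂ⁴`. -/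
theorem exists_linearEquiv_of_coframe {l : Fin 4 → Covector}
    (h : LinearIndependent ℂ
      (Sum.elim (fun j => l j) (fun j => (l j).conj) : Fin 4 ⊕ Fin 4 → Covector)) :
    ∃ e : CoordSpace ≃ₗ[ℝ] (Fin 4 → ℂ), ∀ v j, e v j = l j v := by
  let E : Covector →ₗ[ℂ] (Fin 8 → ℂ) :=
    { toFun := fun l i => l (Pi.single i 1)
      map_add' := fun _ _ => rfl
      map_smul' := fun _ _ => rfl }
  have hE (m : Covector) (v : CoordSpace) : m v = ∑ i, (v i : ℂ) * E m i := by
    conv_lhs => rw [← Finset.univ_sum_single v]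
    rw [map_sum]
    refine Finset.sum_congr rfl fun i _ => ?_
    have : (Pi.single i (v i) : CoordSpace) = v i • Pi.single i 1 := by
      rw [← Pi.single_smul]; simp
    rw [this, map_smul]
    simp [E]
  have hker : LinearMap.ker E = ⊥ := by
    rw [LinearMap.ker_eq_bot']
    intro m hm
    ext v
    simp [hE m v, hm]
  have hspan := (h.map' E hker).span_eq_top_of_card_eq_finrank' (by simp)
  let D : CoordSpace →ₗ[ℝ] (Fin 4 → ℂ) := LinearMap.pi fun j => (l j).toLinearMap
  -- A real vector killed by the `l j` is also killed by their conjugates. These eight covectors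
  -- span all covectors, so every coordinate of the vector vanishes.
  have hD : Function.Injective D := by
    rw [← LinearMap.ker_eq_bot, LinearMap.ker_eq_bot']
    intro v hv
    have hv' (j : Fin 4) : l j v = 0 := congrFun hv j
    let f : (Fin 8 → ℂ) →ₗ[ℂ] ℂ := ∑ i, (v i : ℂ) • LinearMap.proj i
    have hf (w : Fin 8 → ℂ) : f w = ∑ i, (v i : ℂ) * w i := by simp [f]
    have hf0 : f = 0 := by
      refine LinearMap.ext_on_range hspan fun j => ?_
      rcases j with j | j
      · simp [hf, ← hE, hv']
      · simp [hf, ← hE, hv']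
    funext i
    have := hf (Pi.single i 1)
    rw [hf0] at this
    simpa [Pi.single_apply] using this.symm
  refine ⟨LinearMap.linearEquivOfInjective D hD
    (by simp [Module.finrank_pi_fintype, Complex.finrank_real_complex]), fun v j => rfl⟩

/-- The real endomorphism that multiplies the forms of a coframe by a complex number. -/
theorem exists_pullback_eq_smul {l : Fin 4 → Covector}
    (h : LinearIndependent ℂ
      (Sum.elim (fun j => l j) (fun j => (l j).conj) : Fin 4 ⊕ Fin 4 → Covector)) (c : ℂ) :
    ∃ R : CoordSpace →L[ℝ] CoordSpace, ∀ j, (l j).comp R = c • l j := by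
  obtain ⟨e, he⟩ := exists_linearEquiv_of_coframe h
  let m : (Fin 4 → ℂ) →ₗ[ℝ] (Fin 4 → ℂ) := (LinearMap.lsmul ℂ (Fin 4 → ℂ) c).restrictScalars ℝ
  refine ⟨LinearMap.toContinuousLinearMap (e.symm.toLinearMap ∘ₗ m ∘ₗ e.toLinearMap),
    fun j => ?_⟩
  ext v
  simp [← he, m]

/-- Each `θʲ` contributes a factor `c` and each conjugate a factor `c̄`, so pullback by `R` makes
the covectors of type `(p,q)` eigenvectors. The types can then be separated by their eigenvalues. -/
theorem compContinuousLinearMap_of_mem_typeCovectors {θ : FormQuadruple} {x : CoordSpace} {c : ℂ}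
    {R : CoordSpace →L[ℝ] CoordSpace} (hR : ∀ j, (θ j x).comp R = c • θ j x) {k p q : ℕ}
    {β : KCovector k} (hβ : β ∈ typeCovectors θ k p q x) :
    β.compContinuousLinearMap R = (c ^ p * (starRingEnd ℂ) c ^ q) • β := by
  induction hβ using Submodule.span_induction with
  | mem β hβ =>
    obtain ⟨s, J, hp, hq, rfl⟩ := hβ
    have hR' (j : Fin 4) : (θ j x).conj.comp R = (starRingEnd ℂ) c • (θ j x).conj := by
      ext v
      have := congrArg (fun l : Covector => (starRingEnd ℂ) (l v)) (hR j)
      simpa using this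
    rw [wedge_compContinuousLinearMap]
    have : (fun i => (if s i then θ (J i) x else (θ (J i) x).conj : Covector).comp R) =
        fun i => (if s i then c else (starRingEnd ℂ) c) •
          (if s i then θ (J i) x else (θ (J i) x).conj : Covector) := by
      funext i
      cases s i
      · simpa using hR' (J i)
      · simpa using hR (J i)
    rw [this, wedge_smul, Finset.prod_ite, Finset.prod_const, Finset.prod_const, hp]
    simp only [Bool.not_eq_true, hq]
  | zero => rw [smul_zero]; rfl
  | add β γ _ _ hβ hγ => rw [smul_add, ← hβ, ← hγ]; rfl
  | smul a β _ hβ => rw [smul_comm, ← hβ]; rfl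

theorem typeCovectors_eq_bot {θ : FormQuadruple} {x : CoordSpace} {k p q : ℕ} (h : p + q ≠ k) :
    typeCovectors θ k p q x = ⊥ := by
  rw [typeCovectors, Submodule.span_eq_bot]
  rintro β ⟨s, J, hp, hq, rfl⟩
  refine absurd ?_ h
  have := Finset.card_filter_add_card_filter_not (s := (Finset.univ : Finset (Fin k)))
    (fun i => s i = true)
  simp only [Bool.not_eq_true, hp, hq] at this
  simpa using this

/-- The equality says `e^{i(p-q)} = e^{i(r-s)}`, so `(p-q) - (r-s)` is an integer multiple `2πn`,
and irrationality of `π` forces `n = 0`. A root of unity in place of `exp I` could fail: `c = I`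
gives the eigenvalue 1 on both types (4,0) and (2,2). -/
theorem exp_I_pow_mul_injective {k p q r s : ℕ} (h : p + q = k) (h' : r + s = k)
    (he : exp I ^ p * (starRingEnd ℂ) (exp I) ^ q = exp I ^ r * (starRingEnd ℂ) (exp I) ^ s) :
    (r, s) = (p, q) := by
  rw [← exp_conj, conj_I, ← exp_nat_mul, ← exp_nat_mul, ← exp_nat_mul, ← exp_nat_mul, ← exp_add,
    ← exp_add, exp_eq_exp_iff_exists_int] at he
  obtain ⟨n, hn⟩ := he
  have h1 : ((p : ℝ) - q) = r - s + n * (2 * Real.pi) := by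
    have := congrArg Complex.im hn
    simp at this
    linarith
  have hn0 : n = 0 := by
    by_contra hn0
    have hn' : (n : ℝ) ≠ 0 := by exact_mod_cast hn0
    refine irrational_pi ⟨((p : ℚ) - q - r + s) / (2 * n), ?_⟩
    push_cast
    field_simp
    linarith
  subst hn0
  have h2 : (p : ℤ) - q = r - s := by
    have : ((p : ℝ) - q) = r - s := by simpa using h1
    exact_mod_cast this
  ext <;> simp <;> omega

section

variable {Γ : Subgroup NilGroup} {θ : FormQuadruple} {k p q : ℕ}

/-- The spaces of forms of different types are independent. -/
theorem disjoint_typeForms (hθ : IsCoframe θ) (hk : p + q = k) :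
    Disjoint (typeForms Γ θ k p q)
      (⨆ r : ℕ × ℕ, ⨆ _ : r ≠ (p, q), typeForms Γ θ k r.1 r.2) := by
  choose R hR using fun x => exists_pullback_eq_smul (hθ x) (exp I)
  let T : Module.End ℂ (CoordSpace → KCovector k) :=
    { toFun := fun α x => (α x).compContinuousLinearMap (R x)
      map_add' := fun _ _ => rfl
      map_smul' := fun _ _ => rfl }
  let μ (r : ℕ × ℕ) : ℂ := exp I ^ r.1 * (starRingEnd ℂ) (exp I) ^ r.2
  have hT (r : ℕ × ℕ) : typeForms Γ θ k r.1 r.2 ≤ T.eigenspace (μ r) := by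
    intro α hα
    rw [Module.End.mem_eigenspace_iff]
    funext x
    exact compContinuousLinearMap_of_mem_typeCovectors (hR x) (hα.2 x)
  refine (T.eigenspaces_iSupIndep (μ (p, q))).mono (hT (p, q)) (iSup₂_le fun r hr => ?_)
  -- The supremum runs over all pairs of naturals; the pairs with the wrong total degree contribute
  -- only the zero form.
  by_cases hrk : r.1 + r.2 = k
  · exact (hT r).trans (le_iSup₂_of_le (μ r)
      (fun he => hr (exp_I_pow_mul_injective hk hrk he.symm)) le_rfl)
  · intro α hα
    have : α = 0 := by
      funext x
      simpa [typeCovectors_eq_bot hrk] using hα.2 x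
    rw [this]
    exact zero_mem _

/-- Two candidates for the component differ by an element of both the `(p,q)`-space and the span of
the other types, hence by zero. So the chosen component agrees with any explicit one. -/
theorem typeProjection_eq (hθ : IsCoframe θ) (hk : p + q = k) {α β : CoordSpace → KCovector k}
    (hβ : β ∈ typeForms Γ θ k p q)
    (hαβ : α - β ∈ ⨆ r : ℕ × ℕ, ⨆ _ : r ≠ (p, q), typeForms Γ θ k r.1 r.2) :
    typeProjection Γ θ p q α = β := by
  have h : ∃ β, β ∈ typeForms Γ θ k p q ∧
      α - β ∈ ⨆ r : ℕ × ℕ, ⨆ _ : r ≠ (p, q), typeForms Γ θ k r.1 r.2 := ⟨β, hβ, hαβ⟩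
  rw [typeProjection, dif_pos h]
  have h1 := h.choose_spec
  have h2 := sub_mem hαβ h1.2
  rw [sub_sub_sub_cancel_left] at h2
  exact sub_eq_zero.1 (Submodule.disjoint_def.1 (disjoint_typeForms hθ hk) _
    (sub_mem h1.1 hβ) h2)

theorem typeProjection_add_eq (hθ : IsCoframe θ) (hk : p + q = k)
    {β γ : CoordSpace → KCovector k} (hβ : β ∈ typeForms Γ θ k p q) {r s : ℕ}
    (hrs : (r, s) ≠ (p, q)) (hγ : γ ∈ typeForms Γ θ k r s) :
    typeProjection Γ θ p q (β + γ) = β := by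
  refine typeProjection_eq hθ hk hβ ?_
  rw [add_sub_cancel_left]
  exact Submodule.mem_iSup_of_mem (r, s) (Submodule.mem_iSup_of_mem hrs hγ)

theorem typeProjection_eq_self (hθ : IsCoframe θ) (hk : p + q = k)
    {β : CoordSpace → KCovector k} (hβ : β ∈ typeForms Γ θ k p q) :
    typeProjection Γ θ p q β = β := by
  refine typeProjection_eq hθ hk hβ ?_
  rw [sub_self]
  exact zero_mem _

end

/-! ## Wedge products in a coframe -/

theorem wedge_three_deform (a c : Covector) (s : ℂ) :
    wedge ![a + s • a.conj, (a + s • a.conj).conj, c] =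
      (1 - s * (starRingEnd ℂ) s) • wedge ![a, a.conj, c] := by
  ext v
  rw [ContinuousAlternatingMap.smul_apply, wedge_three_apply, wedge_three_apply]
  simp
  ring

theorem wedge_four_deform (a b : Covector) (r s : ℂ) :
    wedge ![a + r • a.conj, (a + r • a.conj).conj, b + s • b.conj, (b + s • b.conj).conj] =
      ((1 - r * (starRingEnd ℂ) r) * (1 - s * (starRingEnd ℂ) s)) •
        wedge ![a, a.conj, b, b.conj] := by
  ext v
  rw [ContinuousAlternatingMap.smul_apply, wedge_four_apply, wedge_four_apply]
  simp only [wedge_three_apply]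
  simp
  ring

theorem wedge_four_swap (a b c d : Covector) : wedge ![a, b, c, d] = wedge ![c, d, a, b] := by
  ext v
  rw [wedge_four_apply, wedge_four_apply]
  simp only [wedge_three_apply]
  simp
  ring

/-- In the complex coordinates given by `l`, evaluation on `e₁, i e₁, e₂, i e₂` gives `(-2i)² = -4`.
-/
theorem wedge_four_ne_zero {l : Fin 4 → Covector}
    (h : LinearIndependent ℂ
      (Sum.elim (fun j => l j) (fun j => (l j).conj) : Fin 4 ⊕ Fin 4 → Covector)) :
    wedge ![l 0, (l 0).conj, l 1, (l 1).conj] ≠ 0 := by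
  obtain ⟨e, he⟩ := exists_linearEquiv_of_coframe h
  intro h0
  have := congrArg (fun β : KCovector 4 => β ![e.symm (Pi.single 0 1), e.symm (Pi.single 0 I),
    e.symm (Pi.single 1 1), e.symm (Pi.single 1 I)]) h0
  simp only [wedge_four_apply, wedge_three_apply] at this
  simp [← he] at this
  ring_nf at this
  norm_num at this

/-! ## Membership in the spaces of forms of a type -/

section

variable {Γ : Subgroup NilGroup} {θ : FormQuadruple}

theorem wedge_mem_typeForms_one_two (hθ : ∀ j, IsInvariantForm (θ j)) (i j k : Fin 4) :
    (fun x => wedge ![θ i x, (θ j x).conj, (θ k x).conj]) ∈ typeForms Γ θ 3 1 2 := by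
  constructor
  · convert IsInvariantForm.wedge_mem_formsOn Γ
      (σ := ![θ i, fun x => (θ j x).conj, fun x => (θ k x).conj]) ?_ using 3 with x
    · funext n; fin_cases n <;> rfl
    · intro n; fin_cases n
      exacts [hθ i, (hθ j).conj, (hθ k).conj]
  · intro x
    refine Submodule.subset_span ⟨![true, false, false], ![i, j, k], by decide, by decide, ?_⟩
    congr 1

theorem wedge_mem_typeForms_two_one (hθ : ∀ j, IsInvariantForm (θ j)) (i j k : Fin 4) :
    (fun x => wedge ![θ i x, (θ j x).conj, θ k x]) ∈ typeForms Γ θ 3 2 1 := by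
  constructor
  · convert IsInvariantForm.wedge_mem_formsOn Γ
      (σ := ![θ i, fun x => (θ j x).conj, θ k]) ?_ using 3 with x
    · funext n; fin_cases n <;> rfl
    · intro n; fin_cases n
      exacts [hθ i, (hθ j).conj, hθ k]
  · intro x
    refine Submodule.subset_span ⟨![true, false, true], ![i, j, k], by decide, by decide, ?_⟩
    congr 1

theorem wedge_mem_typeForms_two_two (hθ : ∀ j, IsInvariantForm (θ j)) (i j k l : Fin 4) :
    (fun x => wedge ![θ i x, (θ j x).conj, θ k x, (θ l x).conj]) ∈ typeForms Γ θ 4 2 2 := by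
  constructor
  · convert IsInvariantForm.wedge_mem_formsOn Γ
      (σ := ![θ i, fun x => (θ j x).conj, θ k, fun x => (θ l x).conj]) ?_ using 3 with x
    · funext n; fin_cases n <;> rfl
    · intro n; fin_cases n
      exacts [hθ i, (hθ j).conj, hθ k, (hθ l).conj]
  · intro x
    refine Submodule.subset_span
      ⟨![true, false, true, false], ![i, j, k, l], by decide, by decide, ?_⟩
    congr 1

end

/-! ## Exterior derivatives in terms of an invariant coframe -/

section

variable {a b e f : CoordSpace → Covector} {x : CoordSpace} {p₀ p₁ q₀ q₁ : ℂ}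

/-- Conjugation commutes with `d`, and `e∧ē` is anti-invariant under conjugation; hence the minus
signs. -/
theorem extDeriv_conj (ha : IsInvariantForm a)
    (hda : extDeriv (fun y => (a y).toOne) x =
      p₀ • wedge ![e x, (e x).conj] + p₁ • wedge ![f x, (f x).conj]) :
    extDeriv (fun y => (a y).conj.toOne) x =
      -((starRingEnd ℂ) p₀) • wedge ![e x, (e x).conj]
        + -((starRingEnd ℂ) p₁) • wedge ![f x, (f x).conj] := by
  ext v
  have hfd : fderiv ℝ (fun y => (a y).conj) x =
      (ContinuousLinearMap.compL ℝ CoordSpace ℂ ℂ (Complex.conjCLE : ℂ →L[ℝ] ℂ)).comp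
        (fderiv ℝ a x) :=
    ((ContinuousLinearMap.compL ℝ CoordSpace ℂ ℂ (Complex.conjCLE : ℂ →L[ℝ] ℂ)).hasFDerivAt.comp
      x (ha.differentiable x).hasFDerivAt).fderiv
  have h := congrArg (fun β : KCovector 2 => (starRingEnd ℂ) (β v)) hda
  simp only [extDeriv_toOne_apply (ha.differentiable x)] at h
  rw [extDeriv_toOne_apply (ha.conj.differentiable x), hfd]
  simp [wedge_two_apply] at h ⊢
  rw [h]
  ring

/-- The Leibniz sign in `da∧b̄ - a∧db̄` cancels the sign from `extDeriv_conj`, and 2-forms commute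
with 1-forms. The two bracketed groups are the future (1,2) and (2,1) parts. -/
theorem extDeriv_wedge_conj (ha : IsInvariantForm a) (hb : IsInvariantForm b)
    (hda : extDeriv (fun y => (a y).toOne) x =
      p₀ • wedge ![e x, (e x).conj] + p₁ • wedge ![f x, (f x).conj])
    (hdb : extDeriv (fun y => (b y).toOne) x =
      q₀ • wedge ![e x, (e x).conj] + q₁ • wedge ![f x, (f x).conj]) :
    extDeriv (fun y => wedge ![a y, (b y).conj]) x =
      (p₀ • wedge ![e x, (e x).conj, (b x).conj] + p₁ • wedge ![f x, (f x).conj, (b x).conj])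
      + ((starRingEnd ℂ) q₀ • wedge ![e x, (e x).conj, a x]
        + (starRingEnd ℂ) q₁ • wedge ![f x, (f x).conj, a x]) := by
  ext v
  rw [extDeriv_wedge_two_apply ha.1 hb.conj.1, hda, extDeriv_conj hb hdb]
  simp [wedge_two_apply, wedge_three_apply]
  ring

/-- Since `e` and `ē` are closed, the result is `e∧ē∧db̄`. The `e∧ē` term of `db̄` is killed by the
factor `e∧ē`, so only `q₁` survives. -/
theorem extDeriv_wedge_closed (he : IsInvariantForm e) (hb : IsInvariantForm b)
    (hde : extDeriv (fun y => (e y).toOne) x = 0)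
    (hdb : extDeriv (fun y => (b y).toOne) x =
      q₀ • wedge ![e x, (e x).conj] + q₁ • wedge ![f x, (f x).conj]) :
    extDeriv (fun y => wedge ![e y, (e y).conj, (b y).conj]) x =
      -((starRingEnd ℂ) q₁) • wedge ![e x, (e x).conj, f x, (f x).conj] := by
  have hde' : extDeriv (fun y => (e y).conj.toOne) x = 0 := by
    rw [extDeriv_conj (e := e) (f := f) (p₀ := 0) (p₁ := 0) he
      (by rw [hde, KCovector.zero_smul, KCovector.zero_smul, add_zero])]
    simp [KCovector.zero_smul]
  ext v
  rw [extDeriv_wedge_three_apply he.1 he.conj.1 hb.conj.1 hde hde', extDeriv_conj hb hdb,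
    ContinuousAlternatingMap.smul_apply, wedge_four_apply]
  simp [wedge_two_apply, wedge_three_apply]
  ring

end

/-- The coefficients of `dηʲ` with respect to `η¹ ∧ η̄¹` and `η² ∧ η̄²`. -/
def structureCoeff (κ : ℂ) : Fin 4 → Fin 2 → ℂ :=
  ![![0, 0], ![0, 0], ![κ, 0], ![0, κ]]

/-- The coefficients of `d(e^{i_φ} ηʲ)` with respect to `η¹ ∧ η̄¹` and `η² ∧ η̄²`. -/
noncomputable def deformCoeff (κ : ℂ) (A : Matrix (Fin 4) (Fin 4) ℂ) (j : Fin 4) (l : Fin 2) : ℂ :=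
  structureCoeff κ j l + ∑ k, A j k * -(starRingEnd ℂ) (structureCoeff κ k l)

section

variable {κ : ℂ} {η : FormQuadruple}

theorem StructureEquations.extDeriv_eq (hη : StructureEquations κ η) (j : Fin 4)
    (x : CoordSpace) :
    extDeriv (fun y => (η j y).toOne) x =
      structureCoeff κ j 0 • wedge ![η 0 x, (η 0 x).conj]
        + structureCoeff κ j 1 • wedge ![η 1 x, (η 1 x).conj] := by
  obtain ⟨h0, h1, h2, h3⟩ := hη x
  fin_cases j
  · simpa [structureCoeff, KCovector.zero_smul] using h0
  · simpa [structureCoeff, KCovector.zero_smul] using h1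
  · simpa [structureCoeff, KCovector.zero_smul] using h2
  · simpa [structureCoeff, KCovector.zero_smul] using h3

theorem isInvariantForm_deform (hη : IsLeftInvariant η) (A : Matrix (Fin 4) (Fin 4) ℂ)
    (j : Fin 4) : IsInvariantForm (deform A η j) :=
  IsInvariantForm.add (hη j)
    (IsInvariantForm.sum Finset.univ fun k => (IsInvariantForm.conj (hη k)).const_smul (A j k))

theorem IsInvariantForm.differentiable_toOne {a : CoordSpace → Covector}
    (ha : IsInvariantForm a) : Differentiable ℝ fun y => (a y).toOne := fun x =>
  (ContinuousAlternatingMap.ofSubsingletonLIE (𝕜 := ℝ) (E := CoordSpace) (F := ℂ)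
      (0 : Fin 1)).differentiableAt.comp x (ha.differentiable x)

theorem extDeriv_deform (hη_inv : IsLeftInvariant η) (hη : StructureEquations κ η)
    (A : Matrix (Fin 4) (Fin 4) ℂ) (j : Fin 4) (x : CoordSpace) :
    extDeriv (fun y => (deform A η j y).toOne) x =
      deformCoeff κ A j 0 • wedge ![η 0 x, (η 0 x).conj]
        + deformCoeff κ A j 1 • wedge ![η 1 x, (η 1 x).conj] := by
  have hc (k : Fin 4) : Differentiable ℝ fun y => (η k y).conj.toOne :=
    (IsInvariantForm.conj (hη_inv k)).differentiable_toOne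
  have hd (k : Fin 4) : DifferentiableAt ℝ (fun y => A j k • (η k y).conj.toOne) x :=
    (hc k x).const_smul (A j k)
  have heq : (fun y => (deform A η j y).toOne) =
      fun y => (η j y).toOne + ∑ k, A j k • (η k y).conj.toOne := by
    funext y
    ext v
    simp [deform, Covector.toOne]
  rw [heq, extDeriv_fun_add (IsInvariantForm.differentiable_toOne (hη_inv j) x)
    (DifferentiableAt.fun_sum fun k _ => hd k), extDeriv_sum _ hd, hη.extDeriv_eq j x]
  simp only [extDeriv_const_smul_complex _ (hc _ x),
    extDeriv_conj (hη_inv _) (hη.extDeriv_eq _ x)]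
  ext v
  simp [deformCoeff, Fin.sum_univ_four]
  ring

end

/-! ## The SKT condition -/

/-- The form `∑ c_{jk} θʲ ∧ θ̄ᵏ`. -/
noncomputable def sesquilinearForm (θ : FormQuadruple) (c : Fin 4 → Fin 4 → ℂ) :
    CoordSpace → KCovector 2 :=
  fun x => ∑ j, ∑ k, c j k • wedge ![θ j x, (θ k x).conj]

theorem sum_sum_mem {M ι : Type*} [Fintype ι] [AddCommGroup M] [Module ℂ M]
    {S : Submodule ℂ M} (c : ι → ι → ℂ) {u : ι → ι → M} (h : ∀ j k, u j k ∈ S) :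
    ∑ j, ∑ k, c j k • u j k ∈ S :=
  S.sum_mem fun j _ => S.sum_mem fun k _ => S.smul_mem _ (h j k)

theorem extDeriv_sum_sum {n : ℕ} (c : Fin 4 → Fin 4 → ℂ)
    {u : Fin 4 → Fin 4 → CoordSpace → KCovector n} {x : CoordSpace}
    (h : ∀ j k, DifferentiableAt ℝ (u j k) x) :
    extDeriv (fun y => ∑ j, ∑ k, c j k • u j k y) x = ∑ j, ∑ k, c j k • extDeriv (u j k) x := by
  have h1 (j k : Fin 4) : DifferentiableAt ℝ (fun y => c j k • u j k y) x :=
    (h j k).const_smul (c j k)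
  rw [extDeriv_sum _ fun j => DifferentiableAt.fun_sum fun k _ => h1 j k]
  refine Finset.sum_congr rfl fun j _ => ?_
  rw [extDeriv_sum _ fun k => h1 j k]
  exact Finset.sum_congr rfl fun k _ => extDeriv_const_smul_complex _ (h j k)

/-- The coefficient of `∂∂̄` of an invariant `(1,1)`-form vanishes if the form is SKT. -/
theorem sum_eq_zero_of_isSKT {Γ : Subgroup NilGroup} {κ : ℂ} {η : FormQuadruple}
    (hη_inv : IsLeftInvariant η) (hη_coframe : IsCoframe η) (hη : StructureEquations κ η)
    {A : Matrix (Fin 4) (Fin 4) ℂ} (hA₀ : ∀ k, k ≠ 0 → A 0 k = 0) (hA₁ : ∀ k, k ≠ 1 → A 1 k = 0)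
    (hθ : IsCoframe (deform A η)) (c : Fin 4 → Fin 4 → ℂ)
    (h : IsSKT Γ (deform A η) (sesquilinearForm (deform A η) c)) :
    ∑ j, ∑ k, c j k * (deformCoeff κ A j 0 * (starRingEnd ℂ) (deformCoeff κ A k 1)
      + deformCoeff κ A j 1 * (starRingEnd ℂ) (deformCoeff κ A k 0)) = 0 := by
  set θ := deform A η with hθ_def
  set P := deformCoeff κ A
  have hinv (j : Fin 4) : IsInvariantForm (θ j) := isInvariantForm_deform hη_inv A j
  have hinv' (j : Fin 4) : IsInvariantForm (η j) := hη_inv j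
  have hd (j : Fin 4) (x : CoordSpace) := extDeriv_deform hη_inv hη A j x
  have h0 (x : CoordSpace) : θ 0 x = η 0 x + A 0 0 • (η 0 x).conj := by
    simp [hθ_def, deform, Fin.sum_univ_four, hA₀, Covector.zero_smul]
  have h1 (x : CoordSpace) : θ 1 x = η 1 x + A 1 1 • (η 1 x).conj := by
    simp [hθ_def, deform, Fin.sum_univ_four, hA₁, Covector.zero_smul]
  set u := 1 - A 0 0 * (starRingEnd ℂ) (A 0 0)
  set w := 1 - A 1 1 * (starRingEnd ℂ) (A 1 1)
  have hvol (x : CoordSpace) : wedge ![θ 0 x, (θ 0 x).conj, θ 1 x, (θ 1 x).conj] =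
      (u * w) • wedge ![η 0 x, (η 0 x).conj, η 1 x, (η 1 x).conj] := by
    rw [h0, h1, wedge_four_deform]
  -- If `|A 0 0|` or `|A 1 1|` were 1, then `θ¹∧θ̄¹∧θ²∧θ̄²` would vanish, against the independence
  -- of the deformed coframe.
  have huw : u * w ≠ 0 := by
    intro h
    have := hvol 0
    rw [h, KCovector.zero_smul] at this
    exact wedge_four_ne_zero (hθ 0) this
  have hu : u ≠ 0 := left_ne_zero_of_mul huw
  have hw : w ≠ 0 := right_ne_zero_of_mul huw
  -- These rewritings show that `η¹∧η̄¹` and `η²∧η̄²` keep type (1,1) for the deformed structure.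
  have e0 (x : CoordSpace) (m : Covector) : wedge ![η 0 x, (η 0 x).conj, m] =
      u⁻¹ • wedge ![θ 0 x, (θ 0 x).conj, m] := by
    rw [h0, wedge_three_deform, inv_smul_smul₀ hu]
  have e1 (x : CoordSpace) (m : Covector) : wedge ![η 1 x, (η 1 x).conj, m] =
      w⁻¹ • wedge ![θ 1 x, (θ 1 x).conj, m] := by
    rw [h1, wedge_three_deform, inv_smul_smul₀ hw]
  -- `β j k` and `γ j k` are the (1,2) and (2,1) parts of `d(θʲ∧θ̄ᵏ)`.
  let β : Fin 4 → Fin 4 → CoordSpace → KCovector 3 := fun j k x =>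
    P j 0 • wedge ![η 0 x, (η 0 x).conj, (θ k x).conj]
      + P j 1 • wedge ![η 1 x, (η 1 x).conj, (θ k x).conj]
  let γ : Fin 4 → Fin 4 → CoordSpace → KCovector 3 := fun j k x =>
    (starRingEnd ℂ) (P k 0) • wedge ![η 0 x, (η 0 x).conj, θ j x]
      + (starRingEnd ℂ) (P k 1) • wedge ![η 1 x, (η 1 x).conj, θ j x]
  have hβ (j k : Fin 4) : β j k ∈ typeForms Γ θ 3 1 2 := by
    simp only [β, e0, e1]
    exact add_mem
      (Submodule.smul_mem _ (P j 0)
        (Submodule.smul_mem _ u⁻¹ (wedge_mem_typeForms_one_two hinv 0 0 k)))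
      (Submodule.smul_mem _ (P j 1)
        (Submodule.smul_mem _ w⁻¹ (wedge_mem_typeForms_one_two hinv 1 1 k)))
  have hγ (j k : Fin 4) : γ j k ∈ typeForms Γ θ 3 2 1 := by
    simp only [γ, e0, e1]
    exact add_mem
      (Submodule.smul_mem _ ((starRingEnd ℂ) (P k 0))
        (Submodule.smul_mem _ u⁻¹ (wedge_mem_typeForms_two_one hinv 0 0 j)))
      (Submodule.smul_mem _ ((starRingEnd ℂ) (P k 1))
        (Submodule.smul_mem _ w⁻¹ (wedge_mem_typeForms_two_one hinv 1 1 j)))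
  have hsmooth {n p q : ℕ} {ψ : CoordSpace → KCovector n} (hψ : ψ ∈ typeForms Γ θ n p q) :
      Differentiable ℝ ψ := hψ.1.1.differentiable (by simp)
  have hdiff₂ (j k : Fin 4) : Differentiable ℝ fun x => wedge ![θ j x, (θ k x).conj] :=
    (contDiff_wedge_two (hinv j).1 (hinv k).conj.1).differentiable (by simp)
  have hdΩ : extDeriv (sesquilinearForm θ c) =
      (∑ j, ∑ k, c j k • β j k) + ∑ j, ∑ k, c j k • γ j k := by
    funext x
    refine (extDeriv_sum_sum c fun j k => hdiff₂ j k x).trans ?_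
    simp only [Pi.add_apply, Finset.sum_apply, Pi.smul_apply, ← Finset.sum_add_distrib]
    refine Finset.sum_congr rfl fun j _ => Finset.sum_congr rfl fun k _ => ?_
    rw [extDeriv_wedge_conj (hinv j) (hinv k) (hd j x) (hd k x)]
    exact smul_add _ _ _
  have hdelbar : delbar Γ θ 1 1 (sesquilinearForm θ c) = ∑ j, ∑ k, c j k • β j k := by
    rw [delbar, hdΩ]
    exact typeProjection_add_eq hθ rfl (sum_sum_mem c hβ) (by decide) (sum_sum_mem c hγ)
  set vol : CoordSpace → KCovector 4 :=
    fun x => wedge ![η 0 x, (η 0 x).conj, η 1 x, (η 1 x).conj] with hvol_def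
  have hvol_mem : vol ∈ typeForms Γ θ 4 2 2 := by
    have : vol = (u * w)⁻¹ • fun x => wedge ![θ 0 x, (θ 0 x).conj, θ 1 x, (θ 1 x).conj] := by
      funext x
      rw [Pi.smul_apply, hvol, inv_smul_smul₀ huw]
    rw [this]
    exact Submodule.smul_mem _ _ (wedge_mem_typeForms_two_two hinv 0 0 1 1)
  have hdwedge (i k : Fin 4) : Differentiable ℝ
      fun x => wedge ![η i x, (η i x).conj, (θ k x).conj] :=
    (contDiff_wedge_three (hinv' i).1 (hinv' i).conj.1 (hinv k).conj.1).differentiable (by simp)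
  have hdβ (j k : Fin 4) (x : CoordSpace) : extDeriv (β j k) x =
      -(P j 0 * (starRingEnd ℂ) (P k 1) + P j 1 * (starRingEnd ℂ) (P k 0)) • vol x := by
    have hk := hd k x
    -- For the summand that starts with `η²∧η̄²` the two terms of `dθᵏ` exchange roles, so that the
    -- surviving one is that of `η¹∧η̄¹`.
    have hswap := (hd k x).trans (add_comm _ _)
    obtain ⟨hd0, hd1, -, -⟩ := hη x
    refine (extDeriv_fun_add ((hdwedge 0 k x).const_smul (P j 0))
      ((hdwedge 1 k x).const_smul (P j 1))).trans ?_
    refine (congrArg₂ (· + ·) (extDeriv_const_smul_complex (P j 0) (hdwedge 0 k x))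
      (extDeriv_const_smul_complex (P j 1) (hdwedge 1 k x))).trans ?_
    rw [extDeriv_wedge_closed (hinv' 0) (hinv k) hd0 hk,
      extDeriv_wedge_closed (hinv' 1) (hinv k) hd1 hswap,
      wedge_four_swap (η 1 x)]
    simp only [hvol_def]
    module
  have hdel : extDeriv (∑ j, ∑ k, c j k • β j k) =
      -(∑ j, ∑ k, c j k * (P j 0 * (starRingEnd ℂ) (P k 1)
        + P j 1 * (starRingEnd ℂ) (P k 0))) • vol := by
    funext x
    have : (∑ j, ∑ k, c j k • β j k) = fun y => ∑ j, ∑ k, c j k • β j k y := by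
      funext y; simp
    rw [this, extDeriv_sum_sum c fun j k => hsmooth (hβ j k) x]
    ext v
    simp only [hdβ, Pi.smul_apply, ContinuousAlternatingMap.sum_apply,
      ContinuousAlternatingMap.smul_apply, smul_eq_mul, ← Finset.sum_neg_distrib, Finset.sum_mul]
    exact Finset.sum_congr rfl fun j _ => Finset.sum_congr rfl fun k _ => by ring
  -- As `d∂̄Ω` is a multiple of the (2,2)-form `vol`, the projection in `∂` leaves it unchanged.
  have hzero := h.2
  rw [hdelbar, del, hdel, typeProjection_eq_self hθ rfl (Submodule.smul_mem _ _ hvol_mem)]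
    at hzero
  by_contra hS
  refine wedge_four_ne_zero (hη_coframe 0) ?_
  ext v
  have hv : -_ * wedge ![η 0 0, (η 0 0).conj, η 1 0, (η 1 0).conj] v = 0 :=
    congrArg (fun ψ : KCovector 4 => ψ v) (congrFun hzero 0)
  exact (mul_eq_zero.1 hv).resolve_left (neg_ne_zero.2 hS)

/-! ## Hermitian metrics -/

/-- The coefficients of the fundamental form with respect to the `θʲ ∧ θ̄ᵏ`. -/
noncomputable def hermitianCoeff (α : Fin 4 → Fin 4 → ℂ) (j k : Fin 4) : ℂ :=
  if j = k then I / 2 * α j j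
  else if j < k then 1 / 2 * α j k else -(1 / 2) * (starRingEnd ℂ) (α k j)

theorem fundamentalForm_eq (θ : FormQuadruple) (α : Fin 4 → Fin 4 → ℂ) :
    fundamentalForm θ α = sesquilinearForm θ (hermitianCoeff α) := by
  funext x
  have i0 : Finset.Ioi (0 : Fin 4) = {1, 2, 3} := by decide
  have i1 : Finset.Ioi (1 : Fin 4) = {2, 3} := by decide
  have i2 : Finset.Ioi (2 : Fin 4) = {3} := by decide
  have i3 : Finset.Ioi (3 : Fin 4) = ∅ := by decide
  simp only [fundamentalForm, sesquilinearForm, hermitianCoeff, Fin.sum_univ_four, i0, i1, i2, i3]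
  -- With the wedge products as opaque vectors, the identity is one of linear combinations.
  generalize hW : (fun j k => wedge ![θ j x, (θ k x).conj]) = W
  simp only [fun j k => congrFun (congrFun hW j) k]
  simp
  module

/-! ## The first-order condition -/

/-- The scalar form of the SKT condition along the curve of deformations. -/
theorem scalar_eq_zero {κ a₁₁ a₂₂ a₃₂ a₃₃ a₃₄ a₄₁ a₄₃ a₄₄ : ℂ} {A : Matrix (Fin 4) (Fin 4) ℂ}
    (hA : A = !![a₁₁, 0, 0, 0; 0, a₂₂, 0, 0; 0, a₃₂, a₃₃, a₃₄; a₄₁, 0, a₄₃, a₄₄]) (t : ℝ)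
    (α : Fin 4 → Fin 4 → ℂ)
    (h : ∑ j, ∑ k, hermitianCoeff α j k *
      (deformCoeff κ ((t : ℂ) • A) j 0 * (starRingEnd ℂ) (deformCoeff κ ((t : ℂ) • A) k 1)
        + deformCoeff κ ((t : ℂ) • A) j 1 *
          (starRingEnd ℂ) (deformCoeff κ ((t : ℂ) • A) k 0)) = 0) :
    κ * (starRingEnd ℂ) κ * (α 2 3 - (starRingEnd ℂ) (α 2 3)) + t *
      (-I * α 2 2 * ((κ - t * a₃₃ * (starRingEnd ℂ) κ) * (starRingEnd ℂ) a₃₄ * κ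
          + a₃₄ * (starRingEnd ℂ) κ * ((starRingEnd ℂ) κ - t * (starRingEnd ℂ) a₃₃ * κ))
        - I * α 3 3 * (a₄₃ * (starRingEnd ℂ) κ * ((starRingEnd ℂ) κ - t * (starRingEnd ℂ) a₄₄ * κ)
          + (κ - t * a₄₄ * (starRingEnd ℂ) κ) * (starRingEnd ℂ) a₄₃ * κ)
        - α 2 3 * (a₃₃ * (starRingEnd ℂ) κ ^ 2 + (starRingEnd ℂ) a₄₄ * κ ^ 2
          - t * (a₃₃ * (starRingEnd ℂ) a₄₄ + a₃₄ * (starRingEnd ℂ) a₄₃) * (κ * (starRingEnd ℂ) κ))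
        + (starRingEnd ℂ) (α 2 3) * ((starRingEnd ℂ) a₃₃ * κ ^ 2 + a₄₄ * (starRingEnd ℂ) κ ^ 2
          - t * (a₄₄ * (starRingEnd ℂ) a₃₃ + a₄₃ * (starRingEnd ℂ) a₃₄) *
            (κ * (starRingEnd ℂ) κ))) = 0 := by
  -- The first two rows of `A` only add multiples of the closed forms `η̄¹` and `η̄²`. For the same
  -- reason `a₃₂` and `a₄₁` drop out of the rows below.
  have k0 (l : Fin 2) : deformCoeff κ ((t : ℂ) • A) 0 l = 0 := by
    fin_cases l <;> simp [deformCoeff, structureCoeff, hA, Fin.sum_univ_four]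
  have k1 (l : Fin 2) : deformCoeff κ ((t : ℂ) • A) 1 l = 0 := by
    fin_cases l <;> simp [deformCoeff, structureCoeff, hA, Fin.sum_univ_four]
  have k20 : deformCoeff κ ((t : ℂ) • A) 2 0 = κ - t * a₃₃ * (starRingEnd ℂ) κ := by
    simp [deformCoeff, structureCoeff, hA, Fin.sum_univ_four, sub_eq_add_neg]
  have k21 : deformCoeff κ ((t : ℂ) • A) 2 1 = -(t * a₃₄ * (starRingEnd ℂ) κ) := by
    simp [deformCoeff, structureCoeff, hA, Fin.sum_univ_four]
  have k30 : deformCoeff κ ((t : ℂ) • A) 3 0 = -(t * a₄₃ * (starRingEnd ℂ) κ) := by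
    simp [deformCoeff, structureCoeff, hA, Fin.sum_univ_four]
  have k31 : deformCoeff κ ((t : ℂ) • A) 3 1 = κ - t * a₄₄ * (starRingEnd ℂ) κ := by
    simp [deformCoeff, structureCoeff, hA, Fin.sum_univ_four, sub_eq_add_neg]
  simp only [Fin.sum_univ_four, k0, k1, k20, k21, k30, k31, hermitianCoeff] at h
  simp at h
  -- The factor 2 clears the halves in `hermitianCoeff`.
  linear_combination 2 * h

/-- If `c (h - h̄) + t G` vanishes near `t = 0`, then so does the derivative
`c (h' - h̄') + G` at `0`. -/
theorem deriv_sub_conj_add_eq_zero {c : ℂ} {h G : ℝ → ℂ} (hh : DifferentiableAt ℝ h 0)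
    (hG : DifferentiableAt ℝ G 0)
    (h0 : ∀ᶠ t : ℝ in nhds 0, c * (h t - (starRingEnd ℂ) (h t)) + t * G t = 0) :
    c * (2 * I * ((deriv h 0).im : ℂ)) + G 0 = 0 := by
  have hconj : HasDerivAt (fun t => (starRingEnd ℂ) (h t)) ((starRingEnd ℂ) (deriv h 0)) 0 :=
    hh.hasDerivAt.star
  have hid : HasDerivAt (fun t : ℝ => (t : ℂ)) 1 0 := Complex.ofRealCLM.hasDerivAt
  -- The derivative of `t G(t)` at 0 is `G(0)`: the term with the derivative of `G` carries the
  -- factor `t = 0`.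
  have hd := ((hh.hasDerivAt.sub hconj).const_mul c).add (hid.mul hG.hasDerivAt)
  have hz := hd.unique ((hasDerivAt_const (0 : ℝ) (0 : ℂ)).congr_of_eventuallyEq h0)
  have hsub : deriv h 0 - (starRingEnd ℂ) (deriv h 0) = 2 * I * ((deriv h 0).im : ℂ) := by
    rw [Complex.sub_conj]; push_cast; ring
  rw [hsub] at hz
  simpa using hz

theorem mainTheorem4
    -- the lattice of the compact nilmanifold `M = Γ \ G`
    (Γ : Subgroup NilGroup) [DiscreteTopology Γ]
    [CompactSpace (Quotient (QuotientGroup.rightRel Γ))]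
    -- the invariant `(1,0)`-coframe that defines the complex structure of `M`
    (κ : ℂ) (hκ : κ ≠ 0) (η : FormQuadruple)
    (hη_inv : IsLeftInvariant η) (hη_coframe : IsCoframe η) (hη : StructureEquations κ η)
    -- the curve of deformations `φ(t) = t ∑ a_{jk} η̄ᵏ ⊗ Z_j`, `|t| < ε`
    (a₁₁ a₂₂ a₃₂ a₃₃ a₃₄ a₄₁ a₄₃ a₄₄ : ℂ) (A : Matrix (Fin 4) (Fin 4) ℂ)
    (hA : A = !![a₁₁, 0, 0, 0; 0, a₂₂, 0, 0; 0, a₃₂, a₃₃, a₃₄; a₄₁, 0, a₄₃, a₄₄])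
    (ε : ℝ) (hε : 0 < ε)
    (hφ : ∀ t ∈ Ioo (-ε) ε, IsCoframe (deform ((t : ℂ) • A) η))
    -- the smooth curve of invariant Hermitian metrics, with the coefficients `α_{jk̄}(t)`, `j ≤ k`
    (α : ℝ → Fin 4 → Fin 4 → ℂ)
    (hα_smooth : ∀ j k, j ≤ k → ContDiffOn ℝ ∞ (fun t => α t j k) (Ioo (-ε) ε))
    (hα_pos : ∀ t ∈ Ioo (-ε) ε, (metricMatrix (α t)).PosDef)
    -- the metrics `ω_t = e^{i_φ(t) | i_φ̄(t)}(ω(t))` are SKT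
    (hSKT : ∀ t ∈ Ioo (-ε) ε,
      IsSKT Γ (deform ((t : ℂ) • A) η) (fundamentalForm (deform ((t : ℂ) • A) η) (α t))) :
    (κ.im = 0 →
      I * α 0 2 2 * (a₃₄ + (starRingEnd ℂ) a₃₄) + I * α 0 3 3 * (a₄₃ + (starRingEnd ℂ) a₄₃)
          + α 0 2 3 * (a₃₃ + (starRingEnd ℂ) a₄₄)
          - (starRingEnd ℂ) (α 0 2 3) * (a₄₄ + (starRingEnd ℂ) a₃₃)
        = 2 * I * ((deriv (fun t => α t 2 3) 0).im : ℂ)) ∧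
    (κ.re = 0 →
      I * α 0 2 2 * (a₃₄ + (starRingEnd ℂ) a₃₄) + I * α 0 3 3 * (a₄₃ + (starRingEnd ℂ) a₄₃)
          + α 0 2 3 * (a₃₃ + (starRingEnd ℂ) a₄₄)
          - (starRingEnd ℂ) (α 0 2 3) * (a₄₄ + (starRingEnd ℂ) a₃₃)
        = -(2 * I * ((deriv (fun t => α t 2 3) 0).im : ℂ))) := by
  have hmem : (0 : ℝ) ∈ Ioo (-ε) ε := ⟨by linarith, hε⟩
  have hnhds : Ioo (-ε) ε ∈ nhds (0 : ℝ) := Ioo_mem_nhds hmem.1 hmem.2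
  have hdiff (j k : Fin 4) (hjk : j ≤ k) : DifferentiableAt ℝ (fun t => α t j k) 0 :=
    ((hα_smooth j k hjk).contDiffAt hnhds).differentiableAt (by simp)
  have h22 := hdiff 2 2 le_rfl
  have h33 := hdiff 3 3 le_rfl
  have h23 := hdiff 2 3 (by decide)
  have hconj : DifferentiableAt ℝ (fun t => (starRingEnd ℂ) (α t 2 3)) 0 := h23.star
  have hid : DifferentiableAt ℝ (fun t : ℝ => (t : ℂ)) 0 :=
    Complex.ofRealCLM.differentiableAt
  have hscalar (t : ℝ) (ht : t ∈ Ioo (-ε) ε) := scalar_eq_zero hA t (α t)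
    (sum_eq_zero_of_isSKT (κ := κ) hη_inv hη_coframe hη (A := (t : ℂ) • A)
      (by intro k hk; subst hA; fin_cases k <;> simp_all)
      (by intro k hk; subst hA; fin_cases k <;> simp_all) (hφ t ht) _
      (fundamentalForm_eq _ (α t) ▸ hSKT t ht))
  -- `G` is the bracket multiplied by `t` in `scalar_eq_zero`; its value at 0 involves `κ` only
  -- through `κ²` and `κ̄²`.
  have key := deriv_sub_conj_add_eq_zero h23 (by fun_prop)
    (Filter.mem_of_superset hnhds hscalar)
  simp only [ofReal_zero, zero_mul, sub_zero] at key
  constructor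
  · intro hκ'
    have hc : (starRingEnd ℂ) κ = κ := conj_eq_iff_im.2 hκ'
    rw [hc] at key
    refine mul_left_cancel₀ (pow_ne_zero 2 hκ) ?_
    linear_combination -key
  · intro hκ'
    -- Now `κ̄² = κ²` as in the real case, but `κ κ̄ = -κ²`, so only the term with the derivative
    -- changes sign.
    have hc : (starRingEnd ℂ) κ = -κ := by
      apply Complex.ext <;> simp [hκ']
    rw [hc] at key
    refine mul_left_cancel₀ (pow_ne_zero 2 hκ) ?_
    linear_combination -key
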